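/- Let $1\le k\le n-1$ be integers. A literal is one of the variables $x_1,\dots,x_n$ or its negation, a clause is a set (disjunction) of literals on different variables, and a CNF formula on $x_1,\dots,x_n$ is a set of clauses; its size is the number of its clauses. Unit clause propagation on a CNF formula $\varphi$ starts from $U=\emptyset$ and repeatedly adds to $U$ a literal $l$ whenever some clause $C\in\varphi$ contains $l$ and $U$ contains the negations of all literals in $C\setminus\{l\}$, and derives the contradiction $\bot$ whenever $U$ contains the negations of all literals of some clause of $\varphi$. Let $\mathrm{UCP}(\varphi)=\{\bot\}$ if the contradiction is derived, and otherwise let $\mathrm{UCP}(\varphi)$ be the set of all derived literals. Formulas $\varphi_1,\varphi_2$ on $x_1,\dots,x_n$ are ucp-equivalent if $\mathrm{UCP}(\varphi_1\wedge\alpha)=\mathrm{UCP}(\varphi_2\wedge\alpha)$ for every partial assignment $\alpha$ of the variables (viewed as a conjunction of literals, i.e. unit clauses). Let $\Psi_{n,k}$ be the CNF formula consisting of all clauses on $x_1,\dots,x_n$ with exactly $k$ negative literals and exactly one positive literal. For integers $m\ge r\ge j\ge 0$, let the covering number $C(m,r,j)$ be the smallest size of a system of $r$-subsets of an $m$-set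 such that every $j$-subset is contained in at least one set of the system, and for $0\le j\le m-1$ let $\mu(m,j)$ be defined by $C(m,j+1,j)=\frac{1}{j+1}\binom{m}{j}\mu(m,j)$. **Proposition.** (i) For all integers $1\le k\le n-1$, every CNF formula on $x_1,\dots,x_n$ ucp-equivalent to $\Psi_{n,k}$ has at least $$n\,C(n-1,k,k-1)=\binom{n}{k}\mu(n-1,k-1)\ \ge\ \binom{n}{k}$$ clauses. (ii) For every real $c$ there are $N\in\mathbb N$ and $K\in\mathbb R$ such that for all integers $n\ge N$ and $1\le k\le n-1$ with $|k-n/2|\le c$, there is a CNF formula on $x_1,\dots,x_n$ ucp-equivalent to $\Psi_{n,k}$ with at most $$6(k+1)\,C(n,k+1,k)=6\binom{n}{k}\mu(n,k)\ \le\ K\ln n\,\binom{n}{k}$$ clauses. -/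

import Mathlib

namespace UcpCNF

/-- A literal on the variables `x_0, …, x_{n-1}`: `(i, true)` is `x_i`, `(i, false)` is `¬ x_i`. -/
abbrev Literal (n : ℕ) := Fin n × Bool

/-- The negation of a literal. -/
def neg {n : ℕ} (l : Literal n) : Literal n := (l.1, !l.2)

/-- A set of literals is a clause (their disjunction) if its literals are on different variables.
The empty set is the contradictory clause. -/
def IsClause {n : ℕ} (C : Finset (Literal n)) : Prop := ∀ l ∈ C, neg l ∉ C

instance {n : ℕ} (C : Finset (Literal n)) : Decidable (IsClause C) := by
  unfold IsClause; infer_instance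

/-- A CNF formula is a finite set of clauses; its size is its cardinality. -/
def IsCNF {n : ℕ} (φ : Finset (Finset (Literal n))) : Prop := ∀ C ∈ φ, IsClause C

/-- Literals derived by unit clause propagation: `l` is derived if some clause `C ∋ l` of `φ` has
the negations of all its other literals already derived (unit clauses are the case `C = {l}`). -/
inductive Derives {n : ℕ} (φ : Finset (Finset (Literal n))) : Literal n → Prop
  | step (C : Finset (Literal n)) (l : Literal n) (hC : C ∈ φ) (hl : l ∈ C)
      (h : ∀ l' ∈ C, l' ≠ l → Derives φ (neg l')) : Derives φ l

/-- Unit clause propagation reaches the contradiction: the negations of all literals of some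
clause are derived (the empty clause is a special case). -/
def DerivesBot {n : ℕ} (φ : Finset (Finset (Literal n))) : Prop :=
  ∃ C ∈ φ, ∀ l ∈ C, Derives φ (neg l)

open Classical in
/-- `UCP φ`: `none` stands for `{⊥}`, and `some U` for the set `U` of derived literals when the
contradiction is not reached. -/
noncomputable def UCP {n : ℕ} (φ : Finset (Finset (Literal n))) : Option (Set (Literal n)) :=
  if DerivesBot φ then none else some {l | Derives φ l}

/-- The unit clauses representing a partial assignment, i.e. a partial map from the variables to
the Boolean values. -/
def assignmentClauses {n : ℕ} (α : Fin n → Option Bool) : Finset (Finset (Literal n)) :=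
  (Finset.univ.filter (fun l : Literal n => α l.1 = some l.2)).image (fun l => {l})

/-- `φ₁` and `φ₂` are ucp-equivalent: `UCP (φ₁ ∧ α) = UCP (φ₂ ∧ α)` for every partial
assignment `α`. -/
def UcpEquiv {n : ℕ} (φ₁ φ₂ : Finset (Finset (Literal n))) : Prop :=
  ∀ α : Fin n → Option Bool, UCP (φ₁ ∪ assignmentClauses α) = UCP (φ₂ ∪ assignmentClauses α)

/-- `Ψ_{n,k}`: all clauses with exactly `k` negative literals and exactly one positive literal. -/
def Psi (n k : ℕ) : Finset (Finset (Literal n)) :=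
  Finset.univ.filter (fun C : Finset (Literal n) =>
    IsClause C ∧ (C.filter (fun l => l.2 = false)).card = k ∧
      (C.filter (fun l => l.2 = true)).card = 1)

/-- A system of `r`-subsets of an `n`-set such that every `k`-subset is contained in at least one
member of the system. -/
def IsCovering (n r k : ℕ) (F : Finset (Finset (Fin n))) : Prop :=
  (∀ B ∈ F, B.card = r) ∧ ∀ A : Finset (Fin n), A.card = k → ∃ B ∈ F, A ⊆ B

/-- The covering number `C(n,r,k)` (such systems exist whenever `k ≤ r ≤ n`). -/
noncomputable def coveringNumber (n r k : ℕ) : ℕ :=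
  sInf {m | ∃ F : Finset (Finset (Fin n)), IsCovering n r k F ∧ F.card = m}

/-- `μ(n,k)`, defined by `C(n,k+1,k) = (1/(k+1)) * (n choose k) * μ(n,k)` for `k ≤ n`. -/
noncomputable def mu (n k : ℕ) : ℝ :=
  ((k : ℝ) + 1) * (coveringNumber n (k + 1) k : ℝ) / (n.choose k : ℝ)

end UcpCNF

/-!
The lower bound comes from single propagation steps. Set a `(k - 1)`-set `P` to true and one more
variable `b` to false. Then `Ψ_{n,k}` propagates that all other variables are false, so an
equivalent formula `φ` has a clause with exactly one literal not falsified by this assignment. As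
clauses of `φ` are implicates of `Ψ_{n,k}`, whose models have fewer than `k` ones or are constantly
one, this clause must be an implication `P ∪ {x} → b` (`UcpEquiv.exists_hornClause_mem`). Hence for
each `b` the bodies of the clauses with head `b` cover all `(k - 1)`-sets avoiding `b`.

For the upper bound, `φ` is chosen inside `Ψ_{n,k}`. For each `(k - 1)`-set `P`, the implications
`P ∪ {x} → y` of `φ` form a directed graph on the variables outside `P`, and `φ` is equivalent to
`Ψ_{n,k}` as soon as all these graphs are strongly connected (`ucpEquiv_Psi_of_exits`). An optimal
covering `F` of the `k`-sets by `(k + 1)`-sets `B`, turned into the implications `B \ {b} → b`, gives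
graphs without isolated vertices. In such a graph on `v` vertices, at most
`√((s + 1) binom(v, s))` sets of size `s` are closed under adjacency: for a maximal independent set
`R`, a closed set `S` is determined by `S ∩ R` and also by `S \ R`, so that pairs of closed sets can
be encoded by single `s`-sets (`card_invariant_sq_le`). Therefore a fixed set of size `s` is closed
for a random permutation of `F` with probability at most `√((s + 1) / binom(v, s))`, and for four
independent permutations with probability at most `((s + 1) / binom(v, s)) ^ 2`. Summed over all `S`
with at most `v / 2` elements this is at most `1 / 2` for large `v`, so some four permutations leave
at most `binom(n, k - 1) / 2` pairs `(P, S)` with `S` closed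
(`IsCovering.exists_card_badPairs_le`). Since `k` is close to `n / 2`, this is at most `binom(n, k)`,
which is at most `(k + 1) |F|`. Two further implications for each such pair, one leaving `S` and one
entering it, make all the graphs strongly connected, with `6 (k + 1) |F|` clauses in total.

The logarithmic bound on `μ(n, k)` is that of a greedy covering (`mu_le_log`).
-/

namespace UcpCNF

/-! ### Covering numbers -/

/-- Every `k`-set lies in a block and a block contains only `k + 1` such sets. -/
theorem IsCovering.choose_le {n k : ℕ} {F : Finset (Finset (Fin n))}
    (hF : IsCovering n (k + 1) k F) : n.choose k ≤ (k + 1) * F.card := by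
  have hsub : (Finset.univ : Finset (Fin n)).powersetCard k ⊆
      F.biUnion fun B => B.powersetCard k := by
    intro A hA
    obtain ⟨B, hB, hAB⟩ := hF.2 A (Finset.mem_powersetCard.1 hA).2
    exact Finset.mem_biUnion.2
      ⟨B, hB, Finset.mem_powersetCard.2 ⟨hAB, (Finset.mem_powersetCard.1 hA).2⟩⟩
  have h1 := (Finset.card_le_card hsub).trans (Finset.card_biUnion_le_card_mul F _ (k + 1)
    fun B hB => by rw [Finset.card_powersetCard, hF.1 B hB, Nat.choose_succ_self_right])
  rwa [Finset.card_powersetCard, Finset.card_univ, Fintype.card_fin, mul_comm] at h1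

theorem isCovering_powersetCard {n k : ℕ} (hk : k < n) :
    IsCovering n (k + 1) k ((Finset.univ : Finset (Fin n)).powersetCard (k + 1)) := by
  refine ⟨fun B hB => (Finset.mem_powersetCard.1 hB).2, fun A hA => ?_⟩
  obtain ⟨B, hAB, hB⟩ := Finset.exists_superset_card_eq (s := A) (n := k + 1) (by omega)
    (by simpa using hk)
  exact ⟨B, Finset.mem_powersetCard.2 ⟨Finset.subset_univ _, hB⟩, hAB⟩

theorem exists_isCovering_card_eq {n k : ℕ} (hk : k < n) :
    ∃ F, IsCovering n (k + 1) k F ∧ F.card = coveringNumber n (k + 1) k :=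
  Nat.sInf_mem (s := {m | ∃ F : Finset (Finset (Fin n)), IsCovering n (k + 1) k F ∧ F.card = m})
    ⟨_, _, isCovering_powersetCard hk, rfl⟩

theorem IsCovering.coveringNumber_le {n r k : ℕ} {F : Finset (Finset (Fin n))}
    (hF : IsCovering n r k F) : coveringNumber n r k ≤ F.card :=
  Nat.sInf_le ⟨F, hF, rfl⟩

theorem choose_le_coveringNumber {n k : ℕ} (hk : k < n) :
    n.choose k ≤ (k + 1) * coveringNumber n (k + 1) k := by
  obtain ⟨F, hF, hcard⟩ := exists_isCovering_card_eq hk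
  exact hcard ▸ hF.choose_le

theorem choose_mul_mu {n k : ℕ} (hk : k ≤ n) :
    (n.choose k : ℝ) * mu n k = ((k : ℝ) + 1) * coveringNumber n (k + 1) k := by
  have : (n.choose k : ℝ) ≠ 0 := by exact_mod_cast (Nat.choose_pos hk).ne'
  rw [mu]
  field_simp

theorem one_le_mu {n k : ℕ} (hk : k < n) : 1 ≤ mu n k := by
  have : (0 : ℝ) < n.choose k := by exact_mod_cast Nat.choose_pos hk.le
  rw [mu, le_div_iff₀ this, one_mul]
  exact_mod_cast choose_le_coveringNumber hk

theorem le_card_filter_superset {n k : ℕ} {A : Finset (Fin n)} (hA : A.card = k) :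
    n - k ≤ (((Finset.univ : Finset (Fin n)).powersetCard (k + 1)).filter (A ⊆ ·)).card := by
  have hinj : Set.InjOn (fun x => insert x A) (Aᶜ : Finset (Fin n)) := by
    intro x hx y hy hxy
    have : x ∈ insert y A := by rw [← show insert x A = insert y A from hxy]; simp
    simpa [show x ∉ A by simpa using hx] using this
  have := Finset.card_image_of_injOn hinj
  rw [Finset.card_compl, Fintype.card_fin, hA] at this
  rw [← this]
  refine Finset.card_le_card fun B hB => ?_
  obtain ⟨x, hx, rfl⟩ := Finset.mem_image.1 hB
  simp only [Finset.mem_compl] at hx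
  simp [Finset.card_insert_of_notMem hx, hA]

/-- The greedy step: some block contains at least the average number of the sets in `U`. -/
theorem exists_block_covering {n k : ℕ} (hk : k < n) (U : Finset (Finset (Fin n)))
    (hU : ∀ A ∈ U, A.card = k) :
    ∃ B : Finset (Fin n), B.card = k + 1 ∧
      ((k : ℝ) + 1) / n.choose k * U.card ≤ (U.filter (· ⊆ B)).card := by
  obtain ⟨T, hT⟩ : ∃ T, T = (Finset.univ : Finset (Fin n)).powersetCard (k + 1) := ⟨_, rfl⟩
  have hTcard : T.card = n.choose (k + 1) := by simp [hT]
  have hTne : T.Nonempty := by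
    rw [← Finset.card_pos, hTcard]; exact Nat.choose_pos hk
  have hdc : ∑ A ∈ U, (T.filter (A ⊆ ·)).card = ∑ B ∈ T, (U.filter (· ⊆ B)).card := by
    simp only [Finset.card_filter]
    exact Finset.sum_comm
  have hle : U.card * (n - k) ≤ ∑ B ∈ T, (U.filter (· ⊆ B)).card := by
    rw [← hdc, ← smul_eq_mul]
    exact Finset.card_nsmul_le_sum _ _ _ fun A hA => hT ▸ le_card_filter_superset (hU A hA)
  have hc : (0 : ℝ) < n.choose k := by exact_mod_cast Nat.choose_pos hk.le
  have hid : (n.choose (k + 1) : ℝ) * (k + 1) = n.choose k * ((n - k : ℕ) : ℝ) := by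
    have := Nat.choose_succ_right_eq n k
    rw [← Nat.cast_mul, ← this]
    push_cast
    ring
  have hsum : ∑ B ∈ T, ((k : ℝ) + 1) / n.choose k * U.card ≤
      ∑ B ∈ T, ((U.filter (· ⊆ B)).card : ℝ) := by
    rw [Finset.sum_const, hTcard, nsmul_eq_mul]
    calc (n.choose (k + 1) : ℝ) * (((k : ℝ) + 1) / n.choose k * U.card)
        = U.card * ((n - k : ℕ) : ℝ) := by
          field_simp
          linear_combination (U.card : ℝ) * hid
      _ ≤ ∑ B ∈ T, ((U.filter (· ⊆ B)).card : ℝ) := by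
          rw [← Nat.cast_mul, ← Nat.cast_sum]
          exact Nat.cast_le.2 hle
  obtain ⟨B, hB, hBle⟩ := Finset.exists_le_of_sum_le hTne hsum
  exact ⟨B, (Finset.mem_powersetCard.1 (hT ▸ hB)).2, hBle⟩

theorem add_one_div_choose_le_one {n k : ℕ} (hk : k < n) : ((k : ℝ) + 1) / n.choose k ≤ 1 := by
  have h : k + 1 ≤ n.choose k := by
    calc k + 1 = (k + 1).choose k := (Nat.choose_succ_self_right k).symm
      _ ≤ n.choose k := Nat.choose_le_choose k hk
  exact div_le_one_of_le₀ (by exact_mod_cast h) (Nat.cast_nonneg _)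

/-- After `t` greedy steps, at most the proportion `(1 - (k + 1) / binom(n, k)) ^ t` of the `k`-sets
is left uncovered. -/
theorem exists_greedy_blocks {n k : ℕ} (hk : k < n) (t : ℕ) :
    ∃ F : Finset (Finset (Fin n)), (∀ B ∈ F, B.card = k + 1) ∧ F.card ≤ t ∧
      ((((Finset.univ : Finset (Fin n)).powersetCard k).filter
        (fun A => ∀ B ∈ F, ¬ A ⊆ B)).card : ℝ) ≤
          (1 - ((k : ℝ) + 1) / n.choose k) ^ t * n.choose k := by
  induction t with
  | zero => exact ⟨∅, by simp, by simp, by simp⟩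
  | succ t ih =>
    obtain ⟨F, hF, hcard, hle⟩ := ih
    set U := ((Finset.univ : Finset (Fin n)).powersetCard k).filter
        (fun A => ∀ B ∈ F, ¬ A ⊆ B) with hUdef
    obtain ⟨B, hB, hBle⟩ := exists_block_covering hk U fun A hA =>
      (Finset.mem_powersetCard.1 (Finset.mem_filter.1 hA).1).2
    refine ⟨insert B F, ?_, (Finset.card_insert_le _ _).trans (by omega), ?_⟩
    · intro B' hB'
      rcases Finset.mem_insert.1 hB' with rfl | h
      exacts [hB, hF _ h]
    · have heq : ((Finset.univ : Finset (Fin n)).powersetCard k).filter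
          (fun A => ∀ B' ∈ insert B F, ¬ A ⊆ B') = U.filter (fun A => ¬ A ⊆ B) := by
        ext A
        simp only [hUdef, Finset.mem_filter, Finset.mem_insert, forall_eq_or_imp]
        tauto
      have hsplit : ((U.filter (· ⊆ B)).card : ℝ) + (U.filter (fun A => ¬ A ⊆ B)).card = U.card := by
        exact_mod_cast Finset.card_filter_add_card_filter_not (s := U) (· ⊆ B)
      have hq : 0 ≤ 1 - ((k : ℝ) + 1) / n.choose k := sub_nonneg.2 (add_one_div_choose_le_one hk)
      rw [heq, pow_succ]
      calc ((U.filter (fun A => ¬ A ⊆ B)).card : ℝ)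
          ≤ (1 - ((k : ℝ) + 1) / n.choose k) * U.card := by linarith
        _ ≤ (1 - ((k : ℝ) + 1) / n.choose k) *
            ((1 - ((k : ℝ) + 1) / n.choose k) ^ t * n.choose k) := by gcongr
        _ = _ := by ring

/-- A near-optimal covering: greedily chosen blocks until about `1 / (k + 1)` of the `k`-sets is
left, and then one block for each remaining set. -/
theorem mu_le_log {n k : ℕ} (hk : k < n) : mu n k ≤ Real.log (k + 1) + 2 := by
  have hc : (0 : ℝ) < n.choose k := by exact_mod_cast Nat.choose_pos hk.le
  have hk1 : (0 : ℝ) < (k : ℝ) + 1 := by positivity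
  set q : ℝ := ((k : ℝ) + 1) / n.choose k with hq
  have hq0 : 0 < q := by positivity
  have hlog : 0 ≤ Real.log ((k : ℝ) + 1) := Real.log_nonneg (by linarith [(k.cast_nonneg : (0:ℝ) ≤ k)])
  have hq1 : q ≤ 1 := add_one_div_choose_le_one hk
  -- After `t` steps the proportion `(1 - q) ^ t` has dropped to `1 / (k + 1)`.
  set t := ⌈Real.log (k + 1) / q⌉₊ with ht
  obtain ⟨F, hF, hcard, hle⟩ := exists_greedy_blocks hk t
  set U := ((Finset.univ : Finset (Fin n)).powersetCard k).filter
        (fun A => ∀ B ∈ F, ¬ A ⊆ B) with hUdef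
  have hext : ∀ A : Finset (Fin n), ∃ B : Finset (Fin n), A.card = k → B.card = k + 1 ∧ A ⊆ B := by
    intro A
    by_cases hA : A.card = k
    · obtain ⟨B, hAB, hB⟩ := Finset.exists_superset_card_eq (s := A) (n := k + 1) (by omega)
        (by simpa using hk)
      exact ⟨B, fun _ => ⟨hB, hAB⟩⟩
    · exact ⟨∅, fun h => absurd h hA⟩
  choose g hg using hext
  have hcov : IsCovering n (k + 1) k (F ∪ U.image g) := by
    refine ⟨fun B hB => ?_, fun A hA => ?_⟩
    · rcases Finset.mem_union.1 hB with h | h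
      · exact hF B h
      · obtain ⟨A, hA, rfl⟩ := Finset.mem_image.1 h
        exact (hg A (Finset.mem_powersetCard.1 (Finset.mem_filter.1 hA).1).2).1
    · by_cases h : ∃ B ∈ F, A ⊆ B
      · obtain ⟨B, hB, hAB⟩ := h
        exact ⟨B, Finset.mem_union_left _ hB, hAB⟩
      · push Not at h
        have hAU : A ∈ U := Finset.mem_filter.2
          ⟨Finset.mem_powersetCard.2 ⟨Finset.subset_univ _, hA⟩, h⟩
        exact ⟨g A, Finset.mem_union_right _ (Finset.mem_image_of_mem _ hAU), (hg A hA).2⟩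
  have hCle : (coveringNumber n (k + 1) k : ℝ) ≤ t + U.card := by
    have := hcov.coveringNumber_le.trans ((Finset.card_union_le _ _).trans
      (add_le_add hcard Finset.card_image_le))
    exact_mod_cast this
  have hpow : (1 - q) ^ t ≤ 1 / ((k : ℝ) + 1) := by
    calc (1 - q) ^ t ≤ (Real.exp (-q)) ^ t :=
          pow_le_pow_left₀ (by linarith) (Real.one_sub_le_exp_neg q) t
      _ = Real.exp (-(t * q)) := by rw [← Real.exp_nat_mul]; ring_nf
      _ ≤ Real.exp (-Real.log (k + 1)) := by
          apply Real.exp_le_exp.2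
          have : Real.log (k + 1) / q ≤ t := Nat.le_ceil _
          rw [div_le_iff₀ hq0] at this
          linarith
      _ = 1 / ((k : ℝ) + 1) := by rw [Real.exp_neg, Real.exp_log hk1, one_div]
  have ht1 : (t : ℝ) ≤ Real.log (k + 1) / q + 1 := (Nat.ceil_lt_add_one (by positivity)).le
  have hU : (U.card : ℝ) ≤ 1 / q := by
    calc (U.card : ℝ) ≤ (1 - q) ^ t * n.choose k := hle
      _ ≤ 1 / ((k : ℝ) + 1) * n.choose k := by gcongr
      _ = 1 / q := by rw [hq]; field_simp
  have hmu : mu n k = q * coveringNumber n (k + 1) k := by rw [mu, hq]; ring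
  rw [hmu]
  calc q * coveringNumber n (k + 1) k ≤ q * (Real.log (k + 1) / q + 1 + 1 / q) := by
        gcongr; linarith
    _ = Real.log (k + 1) + q + 1 := by field_simp
    _ ≤ _ := by linarith

/-! ### Unit clause propagation -/

theorem ucp_eq_iff {n : ℕ} {φ ψ : Finset (Finset (Literal n))} :
    UCP φ = UCP ψ ↔ (DerivesBot φ ↔ DerivesBot ψ) ∧
      (¬ DerivesBot φ → ∀ l, Derives φ l ↔ Derives ψ l) := by
  unfold UCP
  by_cases h1 : DerivesBot φ <;> by_cases h2 : DerivesBot ψ <;> simp [h1, h2, Set.ext_iff]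

theorem Derives.mono {n : ℕ} {φ ψ : Finset (Finset (Literal n))} (h : φ ⊆ ψ) {l : Literal n}
    (hl : Derives φ l) : Derives ψ l := by
  induction hl with
  | step C l hC hl _ ih => exact .step C l (h hC) hl ih

theorem DerivesBot.mono {n : ℕ} {φ ψ : Finset (Finset (Literal n))} (h : φ ⊆ ψ)
    (hφ : DerivesBot φ) : DerivesBot ψ := by
  obtain ⟨C, hC, hall⟩ := hφ
  exact ⟨C, h hC, fun l hl => (hall l hl).mono h⟩

/-- Two complementary derived literals falsify the clause deriving one of them. -/
theorem derivesBot_of_derives_neg {n : ℕ} {φ : Finset (Finset (Literal n))} {l : Literal n}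
    (h : Derives φ l) (h' : Derives φ (neg l)) : DerivesBot φ := by
  obtain ⟨C, _, hC, hl, hall⟩ := h
  refine ⟨C, hC, fun l' hl' => ?_⟩
  by_cases he : l' = l
  · exact he ▸ h'
  · exact hall l' hl' he

theorem mem_assignmentClauses {n : ℕ} {α : Fin n → Option Bool} {C : Finset (Literal n)} :
    C ∈ assignmentClauses α ↔ ∃ l : Literal n, α l.1 = some l.2 ∧ C = {l} := by
  simp only [assignmentClauses, Finset.mem_image, Finset.mem_filter, Finset.mem_univ, true_and]
  exact exists_congr fun l => and_congr_right fun _ => eq_comm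

theorem derives_of_assignment {n : ℕ} {φ : Finset (Finset (Literal n))} {α : Fin n → Option Bool}
    {l : Literal n} (h : α l.1 = some l.2) : Derives (φ ∪ assignmentClauses α) l :=
  .step {l} l (Finset.mem_union_right _ (mem_assignmentClauses.2 ⟨l, h, rfl⟩)) (by simp)
    fun l' hl' hne => absurd (Finset.mem_singleton.1 hl') hne

/-- Soundness of unit clause propagation. -/
theorem Derives.sound {n : ℕ} {φ : Finset (Finset (Literal n))} {τ : Fin n → Bool}
    (hτ : ∀ C ∈ φ, ∃ l ∈ C, τ l.1 = l.2) {l : Literal n} (hl : Derives φ l) : τ l.1 = l.2 := by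
  induction hl with
  | step C l hC hl _ ih =>
    obtain ⟨l', hl', ht⟩ := hτ C hC
    by_cases he : l' = l
    · exact he ▸ ht
    · have := ih l' hl' he
      simp [neg, ht] at this

theorem not_derivesBot_of_satisfies {n : ℕ} {φ : Finset (Finset (Literal n))} {τ : Fin n → Bool}
    (hτ : ∀ C ∈ φ, ∃ l ∈ C, τ l.1 = l.2) : ¬ DerivesBot φ := by
  rintro ⟨C, hC, hall⟩
  obtain ⟨l, hl, ht⟩ := hτ C hC
  have := (hall l hl).sound hτ
  simp [neg, ht] at this

theorem satisfies_union_assignment {n : ℕ} {φ : Finset (Finset (Literal n))} {τ : Fin n → Bool}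
    (hτ : ∀ C ∈ φ, ∃ l ∈ C, τ l.1 = l.2) {α : Fin n → Option Bool}
    (hα : ∀ i b, α i = some b → τ i = b) :
    ∀ C ∈ φ ∪ assignmentClauses α, ∃ l ∈ C, τ l.1 = l.2 := by
  intro C hC
  rcases Finset.mem_union.1 hC with h | h
  · exact hτ C h
  · obtain ⟨l, hl, rfl⟩ := mem_assignmentClauses.1 h
    exact ⟨l, by simp, hα _ _ hl⟩

/-- Equivalent formulas have the same models: a total assignment is a model if and only if
propagation from it reaches no contradiction. -/
theorem UcpEquiv.satisfies {n : ℕ} {φ ψ : Finset (Finset (Literal n))} (h : UcpEquiv φ ψ)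
    {τ : Fin n → Bool} (hτ : ∀ C ∈ ψ, ∃ l ∈ C, τ l.1 = l.2) :
    ∀ C ∈ φ, ∃ l ∈ C, τ l.1 = l.2 := by
  have hψ : ¬ DerivesBot (ψ ∪ assignmentClauses fun i => some (τ i)) :=
    not_derivesBot_of_satisfies (satisfies_union_assignment hτ (by simp))
  rw [← (ucp_eq_iff.1 (h _)).1] at hψ
  intro C hC
  by_contra! hne
  refine hψ ⟨C, Finset.mem_union_left _ hC, fun l hl => derives_of_assignment ?_⟩
  have := hne l hl
  simp only [neg, Option.some.injEq]
  cases h1 : τ l.1 <;> cases h2 : l.2 <;> simp_all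

/-- A literal derived beyond the assignment needs a clause of the formula with only one literal
not falsified by the assignment. -/
theorem Derives.exists_first {n : ℕ} {φ : Finset (Finset (Literal n))} {α : Fin n → Option Bool}
    {l : Literal n} (h : Derives (φ ∪ assignmentClauses α) l) (hl : α l.1 ≠ some l.2) :
    ∃ C ∈ φ, ∃ l ∈ C, α l.1 ≠ some l.2 ∧ ∀ l' ∈ C, l' ≠ l → α l'.1 = some (!l'.2) := by
  induction h with
  | step C l hC hlC _ ih =>
    by_cases hall : ∀ l' ∈ C, l' ≠ l → α l'.1 = some (!l'.2)
    · rcases Finset.mem_union.1 hC with h | h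
      · exact ⟨C, h, l, hlC, hl, hall⟩
      · obtain ⟨l', hl', rfl⟩ := mem_assignmentClauses.1 h
        rw [Finset.mem_singleton.1 hlC] at hl
        exact absurd hl' hl
    · push Not at hall
      obtain ⟨l', hl', hne, hα⟩ := hall
      exact ih l' hl' hne hα

/-! ### The clauses of `Ψ_{n,k}` -/

/-- The implication `⋀ A → b` as a clause. -/
def hornClause {n : ℕ} (A : Finset (Fin n)) (b : Fin n) : Finset (Literal n) :=
  insert (b, true) (A.image fun a => (a, false))

theorem true_mem_hornClause {n : ℕ} {A : Finset (Fin n)} {b x : Fin n} :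
    (x, true) ∈ hornClause A b ↔ x = b := by
  simp [hornClause]

theorem false_mem_hornClause {n : ℕ} {A : Finset (Fin n)} {b x : Fin n} :
    (x, false) ∈ hornClause A b ↔ x ∈ A := by
  simp [hornClause]

theorem hornClause_inj {n : ℕ} {A A' : Finset (Fin n)} {b b' : Fin n}
    (h : hornClause A b = hornClause A' b') : A = A' ∧ b = b' := by
  refine ⟨?_, ?_⟩
  · ext x
    rw [← false_mem_hornClause (b := b), h, false_mem_hornClause]
  · rw [← true_mem_hornClause (A := A'), ← h, true_mem_hornClause]

theorem hornClause_mem_Psi {n : ℕ} {A : Finset (Fin n)} {b : Fin n} (hb : b ∉ A) :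
    hornClause A b ∈ Psi n A.card := by
  have h1 : (hornClause A b).filter (fun l => l.2 = false) = A.image fun a => (a, false) := by
    ext ⟨x, v⟩
    cases v <;> simp [hornClause]
  have h2 : (hornClause A b).filter (fun l => l.2 = true) = {(b, true)} := by
    ext ⟨x, v⟩
    cases v <;> simp [hornClause]
  refine Finset.mem_filter.2 ⟨Finset.mem_univ _, ?_, ?_, ?_⟩
  · rintro ⟨x, v⟩ hx hx'
    cases v
    · rw [false_mem_hornClause] at hx
      rw [neg, Bool.not_false, true_mem_hornClause] at hx'
      exact hb (hx' ▸ hx)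
    · rw [true_mem_hornClause] at hx
      rw [neg, Bool.not_true, false_mem_hornClause] at hx'
      exact hb (hx ▸ hx')
  · rw [h1, Finset.card_image_of_injective _ fun a b h => (Prod.mk.inj h).1]
  · rw [h2, Finset.card_singleton]

theorem exists_hornClause_of_mem_Psi {n k : ℕ} {C : Finset (Literal n)} (hC : C ∈ Psi n k) :
    ∃ A b, A.card = k ∧ b ∉ A ∧ C = hornClause A b := by
  obtain ⟨-, hcl, hneg, hpos⟩ := Finset.mem_filter.1 hC
  obtain ⟨⟨b, v⟩, hb⟩ := Finset.card_eq_one.1 hpos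
  have hmem : ∀ x, (x, true) ∈ C ↔ (x, true) = (b, v) := fun x => by
    rw [← Finset.mem_singleton, ← hb]; simp
  have hbC : (b, v) ∈ C.filter (fun l => l.2 = true) := by rw [hb]; simp
  obtain rfl : v = true := (Finset.mem_filter.1 hbC).2
  have hbC := (Finset.mem_filter.1 hbC).1
  have heq : C = hornClause ((C.filter fun l => l.2 = false).image Prod.fst) b := by
    ext ⟨x, v⟩
    cases v
    · simp [false_mem_hornClause]
    · simp [true_mem_hornClause, hmem]
  refine ⟨_, b, ?_, ?_, heq⟩
  · rw [Finset.card_image_of_injOn, hneg]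
    rintro ⟨x, v⟩ hx ⟨y, w⟩ hy hxy
    simp only [Finset.coe_filter, Set.mem_ofPred_eq] at hx hy
    exact Prod.ext hxy (hx.2.trans hy.2.symm)
  · rw [← false_mem_hornClause (b := b), ← heq]
    exact hcl _ hbC

/-- A total assignment with fewer than `k` ones, or with ones only, is a model of `Ψ_{n,k}`. -/
theorem satisfies_Psi {n k : ℕ} (S : Finset (Fin n)) (hS : S.card < k ∨ S = Finset.univ) :
    ∀ C ∈ Psi n k, ∃ l ∈ C, decide (l.1 ∈ S) = l.2 := by
  intro C hC
  obtain ⟨A, b, hA, -, rfl⟩ := exists_hornClause_of_mem_Psi hC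
  rcases hS with hS | rfl
  · obtain ⟨a, ha, haS⟩ := Finset.exists_mem_notMem_of_card_lt_card (hA ▸ hS)
    exact ⟨(a, false), false_mem_hornClause.2 ha, by simpa using haS⟩
  · exact ⟨(b, true), true_mem_hornClause.2 rfl, by simp⟩

/-! ### The lower bound -/

/-- The assignment setting `P` to true and `b` to false forces the remaining variables in `Ψ_{n,k}`
to be false. A first such propagation step in an equivalent formula `φ` uses a clause with a single
non-falsified literal, and since that clause is an implicate of `Ψ_{n,k}`, it can only be
`P ∪ {x} → b`. -/
theorem UcpEquiv.exists_hornClause_mem {n k : ℕ} (hk : 1 ≤ k) (hkn : k ≤ n - 1)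
    {φ : Finset (Finset (Literal n))} (h : UcpEquiv φ (Psi n k)) {P : Finset (Fin n)} {b : Fin n}
    (hP : P.card = k - 1) (hb : b ∉ P) :
    ∃ x, x ∉ P ∧ x ≠ b ∧ hornClause (insert x P) b ∈ φ := by
  obtain ⟨α, hαt, hαf⟩ : ∃ α : Fin n → Option Bool,
      (∀ i, α i = some true ↔ i ∈ P) ∧ ∀ i, α i = some false ↔ i = b := by
    refine ⟨fun i => if i ∈ P then some true else if i = b then some false else none, ?_, ?_⟩
    · intro i
      by_cases h1 : i ∈ P <;> by_cases h2 : i = b <;> simp [h1, h2]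
    · intro i
      by_cases h1 : i ∈ P
      · simp [h1, show i ≠ b from fun h => hb (h ▸ h1)]
      · by_cases h2 : i = b <;> simp [h1, h2, hb]
  have hmodel : ∀ S : Finset (Fin n), S.card < k ∨ S = Finset.univ →
      ∀ C ∈ φ, ∃ l ∈ C, decide (l.1 ∈ S) = l.2 := fun S hS =>
    h.satisfies (τ := fun i => decide (i ∈ S)) (satisfies_Psi S hS)
  obtain ⟨z, hz⟩ : ∃ z, z ∉ insert b P := by
    by_contra! hall
    have h1 := Finset.card_le_card (s := Finset.univ) fun z _ => hall z
    rw [Finset.card_insert_of_notMem hb, Finset.card_univ, Fintype.card_fin] at h1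
    omega
  simp only [Finset.mem_insert, not_or] at hz
  have hbot : ¬ DerivesBot (Psi n k ∪ assignmentClauses α) := by
    refine not_derivesBot_of_satisfies (τ := fun i => decide (i ∈ P))
      (satisfies_union_assignment (τ := fun i => decide (i ∈ P))
        (satisfies_Psi P (Or.inl (by omega))) fun i v hi => ?_)
    cases v
    · rw [hαf] at hi
      simp [hi, hb]
    · rw [hαt] at hi
      simp [hi]
  have hz1 : Derives (Psi n k ∪ assignmentClauses α) (z, false) := by
    have hmem : hornClause (insert z P) b ∈ Psi n k := by
      have := hornClause_mem_Psi (A := insert z P) (b := b) (by simp [hb, Ne.symm hz.1])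
      rwa [Finset.card_insert_of_notMem hz.2, hP, Nat.sub_add_cancel hk] at this
    refine .step _ _ (Finset.mem_union_left _ hmem) (false_mem_hornClause.2 (by simp)) ?_
    rintro ⟨x, v⟩ hx hne
    apply derives_of_assignment
    cases v
    · rw [false_mem_hornClause, Finset.mem_insert] at hx
      have hxP : x ∈ P := hx.resolve_left fun h => hne (by rw [h])
      exact (hαt x).2 hxP
    · rw [true_mem_hornClause] at hx
      exact (hαf x).2 hx
  have hz2 : Derives (φ ∪ assignmentClauses α) (z, false) := by
    have heq := ucp_eq_iff.1 (h α)
    rw [heq.1] at heq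
    exact (heq.2 hbot _).2 hz1
  obtain ⟨C, hC, ⟨x, v⟩, hlC, hlα, hall⟩ := hz2.exists_first
    (by rw [Ne, hαf]; exact hz.1)
  -- The remaining literal of `C` is true in the model with ones exactly on `P`.
  have hxv : decide (x ∈ P) = v := by
    obtain ⟨⟨y, w⟩, hy, hyP⟩ := hmodel P (Or.inl (by omega)) C hC
    by_cases he : (y, w) = (x, v)
    · obtain ⟨rfl, rfl⟩ := Prod.mk.inj he
      exact hyP
    · have := hall _ hy he
      cases w
      · exact absurd ((hαt y).1 this) (by simpa using hyP)
      · have hyb : y = b := (hαf y).1 this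
        exact absurd (show y ∈ P by simpa using hyP) (hyb ▸ hb)
  have hxP : x ∉ P := fun hx => hlα (by rw [← hxv, decide_eq_true hx]; exact (hαt x).2 hx)
  obtain rfl : v = false := by simpa [hxP] using hxv.symm
  have hxb : x ≠ b := fun hx => hlα ((hαf x).2 hx)
  have hfalse : ∀ y, (y, false) ∈ C → y ∈ insert x P := by
    intro y hy
    by_cases he : y = x
    · simp [he]
    · exact Finset.mem_insert_of_mem ((hαt y).1 (hall _ hy (by simpa using he)))
  have htrue : ∀ y, (y, true) ∈ C → y = b := by
    intro y hy
    exact (hαf y).1 (hall _ hy (by simp))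
  refine ⟨x, hxP, hxb, ?_⟩
  convert hC
  ext ⟨y, w⟩
  cases w
  · rw [false_mem_hornClause]
    refine ⟨fun hy => ?_, hfalse y⟩
    by_contra hyC
    have hyP : y ∈ P := (Finset.mem_insert.1 hy).resolve_left fun h => hyC (h ▸ hlC)
    -- If `¬ y` is missing, then `C` is falsified by the model with ones on `P \ {y} ∪ {x}`.
    have hcard : (insert x (P.erase y)).card < k := by
      rw [Finset.card_insert_of_notMem (by simp [hxP]), Finset.card_erase_of_mem hyP, hP]
      have := Finset.card_pos.2 ⟨y, hyP⟩
      omega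
    obtain ⟨⟨u, w⟩, hu, hval⟩ := hmodel _ (Or.inl hcard) C hC
    cases w
    · have h1 := hfalse u hu
      have h2 : u ≠ y := fun h => hyC (h ▸ hu)
      simp_all
    · have h1 := htrue u hu
      simp_all [Ne.symm hxb]
  · rw [true_mem_hornClause]
    refine ⟨fun hy => ?_, htrue y⟩
    obtain ⟨⟨u, w⟩, hu, hval⟩ := hmodel _ (Or.inr rfl) C hC
    obtain rfl : w = true := by simpa using hval.symm
    rwa [hy, ← htrue u hu]

/-- For each `b`, the bodies `A` of the clauses `A → b` in `φ` form a covering of the other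
variables. -/
theorem lower_bound {n k : ℕ} (hk : 1 ≤ k) (hkn : k ≤ n - 1)
    {φ : Finset (Finset (Literal n))} (h : UcpEquiv φ (Psi n k)) :
    n * coveringNumber (n - 1) k (k - 1) ≤ φ.card := by
  obtain ⟨m, rfl⟩ : ∃ m, n = m + 1 := ⟨n - 1, by omega⟩
  rw [Nat.add_sub_cancel]
  let F : Fin (m + 1) → Finset (Finset (Fin m)) := fun b =>
    Finset.univ.filter fun A => A.card = k ∧ hornClause (A.map b.succAboveEmb) b ∈ φ
  have hF : ∀ b, IsCovering m k (k - 1) (F b) := by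
    refine fun b => ⟨fun A hA => (Finset.mem_filter.1 hA).2.1, fun P hP => ?_⟩
    obtain ⟨x, hx, hxb, hmem⟩ := h.exists_hornClause_mem hk hkn
      (P := P.map b.succAboveEmb) (b := b) (by simpa using hP) (by simp [Fin.succAbove_ne])
    obtain ⟨y, rfl⟩ := Fin.exists_succAbove_eq hxb
    have hy : y ∉ P := fun hy => hx (Finset.mem_map.2 ⟨y, hy, rfl⟩)
    refine ⟨insert y P, Finset.mem_filter.2 ⟨Finset.mem_univ _, ?_, ?_⟩, Finset.subset_insert _ _⟩
    · rw [Finset.card_insert_of_notMem hy, hP, Nat.sub_add_cancel hk]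
    · rwa [Finset.map_insert]
  calc (m + 1) * coveringNumber m k (k - 1) ≤ ∑ b, (F b).card := by
        have := Finset.card_nsmul_le_sum (Finset.univ : Finset (Fin (m + 1))) (fun b => (F b).card)
          (coveringNumber m k (k - 1)) fun b _ => (hF b).coveringNumber_le
        simpa using this
    _ = (Finset.univ.sigma F).card := (Finset.card_sigma _ _).symm
    _ ≤ φ.card := by
        refine Finset.card_le_card_of_injOn (fun p => hornClause (p.2.map p.1.succAboveEmb) p.1)
          (fun p hp => ?_) ?_
        · exact (Finset.mem_filter.1 (Finset.mem_sigma.1 hp).2).2.2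
        · rintro ⟨b, A⟩ - ⟨b', A'⟩ - hEq
          have hb : b = b' := (hornClause_inj hEq).2
          subst hb
          have hA : A = A' := Finset.map_injective b.succAboveEmb (hornClause_inj hEq).1
          rw [hA]

/-! ### A sufficient condition for equivalence with `Ψ_{n,k}` -/

/-- If for every `(k - 1)`-set `P` the implications `P ∪ {x} → y` in `φ` leave no nontrivial
set of variables outside `P`, then `φ` propagates everything that the larger formula `Ψ_{n,k}`
does. -/
theorem ucpEquiv_Psi_of_exits {n k : ℕ} (hk : 1 ≤ k) {φ : Finset (Finset (Literal n))}
    (hφ : φ ⊆ Psi n k)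
    (hexit : ∀ P S : Finset (Fin n), P.card + 1 = k → Disjoint P S → S.Nonempty →
      (∃ y, y ∉ P ∧ y ∉ S) → ∃ x ∈ S, ∃ y, y ∉ P ∧ y ∉ S ∧ hornClause (insert x P) y ∈ φ) :
    UcpEquiv φ (Psi n k) := by
  classical
  intro α
  have hsub : φ ∪ assignmentClauses α ⊆ Psi n k ∪ assignmentClauses α :=
    Finset.union_subset_union_left hφ
  -- Literals derived by `φ` are closed under the propagation steps of `Ψ_{n,k}`.
  have hder : ∀ l, Derives (Psi n k ∪ assignmentClauses α) l →
      Derives (φ ∪ assignmentClauses α) l := by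
    intro l hl
    induction hl with
    | step C l hC hl _ ih =>
      rcases Finset.mem_union.1 hC with h | h
      swap
      · exact .step C l (Finset.mem_union_right _ h) hl ih
      obtain ⟨A, b, hA, hbA, rfl⟩ := exists_hornClause_of_mem_Psi h
      by_contra hnot
      obtain ⟨c, v⟩ := l
      cases v
      · -- Deriving `¬ c`: take for `S` the variables outside `A \ {c}` not derived negatively.
        rw [false_mem_hornClause] at hl
        have hpos : ∀ a ∈ A.erase c, Derives (φ ∪ assignmentClauses α) (a, true) := fun a ha => by
          have := ih (a, false) (false_mem_hornClause.2 (Finset.mem_of_mem_erase ha))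
            (by simpa using Finset.ne_of_mem_erase ha)
          simpa [neg] using this
        have hb : Derives (φ ∪ assignmentClauses α) (b, false) := by
          have := ih (b, true) (true_mem_hornClause.2 rfl) (by simp)
          simpa [neg] using this
        obtain ⟨x, hx, y, hyP, hyS, hmem⟩ := hexit (A.erase c)
          (Finset.univ.filter fun x => x ∉ A.erase c ∧ ¬ Derives (φ ∪ assignmentClauses α) (x, false))
          (by rw [Finset.card_erase_add_one hl, hA])
          (Finset.disjoint_left.2 fun x hx hx' => (Finset.mem_filter.1 hx').2.1 hx)
          ⟨c, by simp [hnot]⟩ ⟨b, by simp [hbA], by simp [hb]⟩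
        simp only [Finset.mem_filter, Finset.mem_univ, true_and, not_and, not_not] at hx hyS
        refine hx.2 (.step _ _ (Finset.mem_union_left _ hmem)
          (false_mem_hornClause.2 (Finset.mem_insert_self _ _)) ?_)
        rintro ⟨u, w⟩ hu hne
        cases w
        · rw [false_mem_hornClause, Finset.mem_insert] at hu
          exact hpos u (hu.resolve_left fun h => hne (by rw [h]))
        · rw [true_mem_hornClause] at hu
          subst hu
          exact hyS hyP
      · -- Deriving `c`: take for `S` the variables outside `A \ {a}` derived positively.
        rw [true_mem_hornClause] at hl
        subst hl
        have hpos : ∀ a ∈ A, Derives (φ ∪ assignmentClauses α) (a, true) := fun a ha => by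
          have := ih (a, false) (false_mem_hornClause.2 ha) (by simp)
          simpa [neg] using this
        obtain ⟨a, ha⟩ := Finset.card_pos.1 (hA ▸ hk)
        obtain ⟨x, hx, y, hyP, hyS, hmem⟩ := hexit (A.erase a)
          (Finset.univ.filter fun x => x ∉ A.erase a ∧ Derives (φ ∪ assignmentClauses α) (x, true))
          (by rw [Finset.card_erase_add_one ha, hA])
          (Finset.disjoint_left.2 fun x hx hx' => (Finset.mem_filter.1 hx').2.1 hx)
          ⟨a, by simp [hpos a ha]⟩ ⟨c, by simp [hbA], by simp [hnot]⟩
        simp only [Finset.mem_filter, Finset.mem_univ, true_and, not_and] at hx hyS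
        refine hyS hyP (.step _ _ (Finset.mem_union_left _ hmem)
          (true_mem_hornClause.2 rfl) ?_)
        rintro ⟨u, w⟩ hu hne
        cases w
        · rw [false_mem_hornClause, Finset.mem_insert] at hu
          rcases hu with rfl | hu
          · exact hx.2
          · exact hpos u (Finset.mem_of_mem_erase hu)
        · rw [true_mem_hornClause] at hu
          exact absurd (by rw [hu]) hne
  rw [ucp_eq_iff]
  refine ⟨⟨fun h => h.mono hsub, ?_⟩, fun _ l => ⟨fun h => h.mono hsub, hder l⟩⟩
  rintro ⟨C, hC, hall⟩
  rcases Finset.mem_union.1 hC with h | h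
  · obtain ⟨A, b, -, -, rfl⟩ := exists_hornClause_of_mem_Psi h
    have hb : (b, true) ∈ hornClause A b := true_mem_hornClause.2 rfl
    exact derivesBot_of_derives_neg (hder _ (.step _ _ hC hb fun l' hl' _ => hall l' hl'))
      (hder _ (hall _ hb))
  · exact ⟨C, Finset.mem_union_right _ h, fun l hl => hder _ (hall l hl)⟩

/-! ### Closed sets in the links of a covering -/

/-- A set `S` is closed in the link of `P` if it is a union of connected components of the graph
on the elements outside `P` whose edges are the pairs `{x, y}` with `P ∪ {x, y} ∈ F`. -/
def LinkClosed {n : ℕ} (F : Finset (Finset (Fin n))) (P S : Finset (Fin n)) : Prop :=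
  ∀ x ∈ S, ∀ y, y ∉ P → y ≠ x → insert x (insert y P) ∈ F → y ∈ S

/-- A maximal independent set `R` of a graph separates every non-isolated vertex from one of its
neighbours. -/
theorem exists_separating_set {α : Type*} [Fintype α] [DecidableEq α] (adj : α → α → Prop)
    (hsymm : ∀ x y, adj x y → adj y x) (hirr : ∀ x, ¬ adj x x) :
    ∃ R : Finset α, ∀ x, (∃ y, adj x y) → ∃ y, adj x y ∧ (y ∈ R ↔ x ∉ R) := by
  classical
  obtain ⟨R, hR, hmax⟩ := Finset.exists_max_image
    ((Finset.univ : Finset (Finset α)).filter fun R => ∀ x ∈ R, ∀ y ∈ R, ¬ adj x y)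
    Finset.card ⟨∅, by simp⟩
  have hind := (Finset.mem_filter.1 hR).2
  refine ⟨R, fun x hx => ?_⟩
  by_cases hxR : x ∈ R
  · obtain ⟨y, hy⟩ := hx
    exact ⟨y, hy, by simp only [hxR, not_true_eq_false, iff_false]; exact fun h => hind x hxR y h hy⟩
  · by_contra! hno
    have hnadj : ∀ y ∈ R, ¬ adj x y := fun y hy h => by
      rcases hno y h with h | h
      · exact hxR h.2
      · exact h.1 hy
    have := hmax (insert x R) (Finset.mem_filter.2 ⟨Finset.mem_univ _, fun u hu w hw => by
      rcases Finset.mem_insert.1 hu with hu | hu <;> rcases Finset.mem_insert.1 hw with hw | hw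
      · exact hu ▸ hw ▸ hirr x
      · exact hu ▸ hnadj w hw
      · exact fun h => hnadj u hu (hsymm _ _ (hw ▸ h))
      · exact hind u hu w hw⟩)
    rw [Finset.card_insert_of_notMem hxR] at this
    omega

/-- If `f` exchanges `R` with its complement, an `f`-invariant set `S` is determined by either of
the parts `S ∩ R` and `S \ R`. Combining parts of two invariant sets therefore embeds pairs of
invariant sets with equally large parts in `R` into the `s`-subsets of `W`. -/
theorem card_invariant_sq_le {α : Type*} [DecidableEq α] {W R : Finset α} {f : α → α} {s : ℕ}
    (hfR : ∀ x ∈ W, (f x ∈ R ↔ x ∉ R)) (𝒮 : Finset (Finset α))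
    (hW : ∀ S ∈ 𝒮, S ⊆ W) (hs : ∀ S ∈ 𝒮, S.card = s)
    (hf : ∀ S ∈ 𝒮, ∀ x ∈ W, (x ∈ S ↔ f x ∈ S)) :
    𝒮.card ^ 2 ≤ (s + 1) * W.card.choose s := by
  have hmaps : ∀ S ∈ 𝒮, (S ∩ R).card ∈ Finset.range (s + 1) := fun S hS => by
    have := Finset.card_le_card (Finset.inter_subset_left (s₁ := S) (s₂ := R))
    rw [hs S hS] at this
    exact Finset.mem_range.2 (by omega)
  have hpart : ∀ a ∈ Finset.range (s + 1), (𝒮.filter fun S => (S ∩ R).card = a).card ^ 2 ≤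
      ((W.powersetCard s).filter fun U => (U ∩ R).card = a).card := by
    intro a _
    rw [sq, ← Finset.card_product]
    have hR : ∀ S S' : Finset α, ((S ∩ R) ∪ (S' \ R)) ∩ R = S ∩ R := fun S S' => by
      ext x; simp; tauto
    have hR' : ∀ S S' : Finset α, ((S ∩ R) ∪ (S' \ R)) \ R = S' \ R := fun S S' => by
      ext x; simp; tauto
    refine Finset.card_le_card_of_injOn (fun q => (q.1 ∩ R) ∪ (q.2 \ R)) ?_ ?_
    · rintro ⟨S, S'⟩ hq
      obtain ⟨hS, hS'⟩ := Finset.mem_product.1 hq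
      obtain ⟨hS, ha⟩ := Finset.mem_filter.1 hS
      obtain ⟨hS', ha'⟩ := Finset.mem_filter.1 hS'
      simp only at hS hS' ha ha'
      refine Finset.mem_coe.2 (Finset.mem_filter.2 ⟨Finset.mem_powersetCard.2 ⟨?_, ?_⟩, ?_⟩)
      · exact Finset.union_subset (Finset.inter_subset_left.trans (hW S hS))
          (Finset.sdiff_subset.trans (hW S' hS'))
      · rw [Finset.card_union_of_disjoint
          (Finset.disjoint_left.2 fun x hx hx' =>
            (Finset.mem_sdiff.1 hx').2 (Finset.mem_inter.1 hx).2), ha, ← ha', ← hs S' hS',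
          Finset.card_inter_add_card_sdiff]
      · simp only [hR, ha]
    · rintro ⟨S, S'⟩ hq ⟨T, T'⟩ hq' heq
      obtain ⟨hS, hS'⟩ := Finset.mem_product.1 hq
      obtain ⟨hT, hT'⟩ := Finset.mem_product.1 hq'
      replace hS := (Finset.mem_filter.1 hS).1
      replace hS' := (Finset.mem_filter.1 hS').1
      replace hT := (Finset.mem_filter.1 hT).1
      replace hT' := (Finset.mem_filter.1 hT').1
      simp only at hS hS' hT hT' heq
      have h1 : S ∩ R = T ∩ R := by rw [← hR S S', heq, hR]
      have h2 : S' \ R = T' \ R := by rw [← hR' S S', heq, hR']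
      have hin : ∀ x ∈ R, (x ∈ S ↔ x ∈ T) := fun x hx => by
        have := Finset.ext_iff.1 h1 x
        simpa [hx] using this
      have hout : ∀ x, x ∉ R → (x ∈ S' ↔ x ∈ T') := fun x hx => by
        have := Finset.ext_iff.1 h2 x
        simpa [hx] using this
      refine Prod.ext ?_ ?_
      · ext x
        by_cases hxW : x ∈ W
        · by_cases hxR : x ∈ R
          · exact hin x hxR
          · rw [hf S hS x hxW, hf T hT x hxW]
            exact hin _ ((hfR x hxW).2 hxR)
        · exact ⟨fun h => absurd (hW S hS h) hxW, fun h => absurd (hW T hT h) hxW⟩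
      · ext x
        by_cases hxW : x ∈ W
        · by_cases hxR : x ∈ R
          · show x ∈ S' ↔ x ∈ T'
            rw [hf S' hS' x hxW, hf T' hT' x hxW]
            exact hout _ fun h => (hfR x hxW).1 h hxR
          · exact hout x hxR
        · exact ⟨fun h => absurd (hW S' hS' h) hxW, fun h => absurd (hW T' hT' h) hxW⟩
  have hmaps' : ∀ U ∈ W.powersetCard s, (U ∩ R).card ∈ Finset.range (s + 1) := fun U hU => by
    have := Finset.card_le_card (Finset.inter_subset_left (s₁ := U) (s₂ := R))
    rw [(Finset.mem_powersetCard.1 hU).2] at this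
    exact Finset.mem_range.2 (by omega)
  rw [Finset.card_eq_sum_card_fiberwise hmaps]
  calc (∑ a ∈ Finset.range (s + 1), (𝒮.filter fun S => (S ∩ R).card = a).card) ^ 2
      ≤ (Finset.range (s + 1)).card *
        ∑ a ∈ Finset.range (s + 1), (𝒮.filter fun S => (S ∩ R).card = a).card ^ 2 :=
        sq_sum_le_card_mul_sum_sq
    _ ≤ (s + 1) * ∑ a ∈ Finset.range (s + 1),
        ((W.powersetCard s).filter fun U => (U ∩ R).card = a).card := by
        rw [Finset.card_range]
        exact Nat.mul_le_mul_left _ (Finset.sum_le_sum hpart)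
    _ = (s + 1) * W.card.choose s := by
        rw [← Finset.card_eq_sum_card_fiberwise hmaps', Finset.card_powersetCard]

open Classical in
/-- The covering property says that links have no isolated vertices, so that a separating set
yields a map exchanging it with its complement and preserving all closed sets. -/
theorem IsCovering.card_linkClosed_sq_le {n p : ℕ} {F : Finset (Finset (Fin n))}
    (hF : IsCovering n (p + 1 + 1) (p + 1) F) {P : Finset (Fin n)} (hP : P.card = p) (s : ℕ) :
    (((Pᶜ : Finset (Fin n)).powersetCard s).filter (LinkClosed F P)).card ^ 2 ≤
      (s + 1) * (n - p).choose s := by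
  let adj : Fin n → Fin n → Prop := fun x y =>
    x ∉ P ∧ y ∉ P ∧ y ≠ x ∧ insert x (insert y P) ∈ F
  obtain ⟨R, hR⟩ := exists_separating_set adj
    (fun x y ⟨hx, hy, hne, hmem⟩ => ⟨hy, hx, hne.symm, Finset.insert_comm x y P ▸ hmem⟩)
    (fun x h => h.2.2.1 rfl)
  have hpartner : ∀ x, ∃ y, x ∉ P → adj x y ∧ (y ∈ R ↔ x ∉ R) := by
    intro x
    by_cases hx : x ∈ P
    · exact ⟨x, fun h => absurd hx h⟩
    obtain ⟨B, hB, hsub⟩ := hF.2 (insert x P) (by rw [Finset.card_insert_of_notMem hx, hP])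
    obtain ⟨y, hy⟩ : ∃ y, B \ insert x P = {y} := by
      rw [← Finset.card_eq_one, Finset.card_sdiff_of_subset hsub, hF.1 B hB,
        Finset.card_insert_of_notMem hx, hP]
      omega
    have hyB : y ∈ B \ insert x P := by rw [hy]; simp
    simp only [Finset.mem_sdiff, Finset.mem_insert, not_or] at hyB
    have hBeq : insert x (insert y P) = B := by
      rw [Finset.insert_comm, ← Finset.sdiff_union_of_subset hsub, hy, Finset.singleton_union]
    obtain ⟨z, hz⟩ := hR x ⟨y, hx, hyB.2.2, hyB.2.1, hBeq ▸ hB⟩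
    exact ⟨z, fun _ => hz⟩
  choose f hf using hpartner
  have := card_invariant_sq_le (W := Pᶜ) (R := R) (f := f) (s := s)
    (fun x hx => (hf x (Finset.mem_compl.1 hx)).2)
    (((Pᶜ : Finset (Fin n)).powersetCard s).filter (LinkClosed F P))
    (fun S hS => (Finset.mem_powersetCard.1 (Finset.mem_filter.1 hS).1).1)
    (fun S hS => (Finset.mem_powersetCard.1 (Finset.mem_filter.1 hS).1).2)
    (fun S hS x hx => by
      obtain ⟨⟨hxP, hyP, hne, hmem⟩, -⟩ := hf x (Finset.mem_compl.1 hx)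
      have hcl := (Finset.mem_filter.1 hS).2
      exact ⟨fun h => hcl x h _ hyP hne hmem,
        fun h => hcl _ h x hxP hne.symm (Finset.insert_comm x (f x) P ▸ hmem)⟩)
  rwa [Finset.card_compl, Fintype.card_fin, hP] at this

/-! ### Random permutations of a covering -/

/-- The symmetric group is transitive on pairs of disjoint sets of given sizes. -/
theorem exists_perm_map {n : ℕ} {P S P' S' : Finset (Fin n)} (h : Disjoint P S)
    (h' : Disjoint P' S') (hP : P.card = P'.card) (hS : S.card = S'.card) :
    ∃ σ : Equiv.Perm (Fin n), P.map σ.toEmbedding = P' ∧ S.map σ.toEmbedding = S' := by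
  classical
  let c : Finset (Fin n) → Finset (Fin n) → Fin n → Fin 3 := fun P S x =>
    if x ∈ P then 0 else if x ∈ S then 1 else 2
  have hc0 : ∀ P S x, c P S x = 0 ↔ x ∈ P := fun P S x => by
    by_cases h1 : x ∈ P <;> by_cases h2 : x ∈ S <;> simp [c, h1, h2]
  have hc1 : ∀ P S, Disjoint P S → ∀ x, c P S x = 1 ↔ x ∈ S := fun P S h x => by
    by_cases h1 : x ∈ P
    · simp [c, h1, Finset.disjoint_left.1 h h1]
    · by_cases h2 : x ∈ S <;> simp [c, h1, h2]
  have hc2 : ∀ P S x, c P S x = 2 ↔ x ∈ (P ∪ S)ᶜ := fun P S x => by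
    by_cases h1 : x ∈ P <;> by_cases h2 : x ∈ S <;> simp [c, h1, h2]
  have hcard : ∀ i : Fin 3, Nonempty ({x // c P S x = i} ≃ {x // c P' S' x = i}) := by
    intro i
    rw [← Fintype.card_eq, Fintype.card_subtype, Fintype.card_subtype]
    fin_cases i
    · simpa [hc0] using hP
    · simpa [hc1 P S h, hc1 P' S' h'] using hS
    · simp only [Fin.reduceFinMk, hc2, Finset.filter_mem_eq_inter, Finset.univ_inter]
      rw [Finset.card_compl, Finset.card_compl, Finset.card_union_of_disjoint h,
        Finset.card_union_of_disjoint h', hP, hS]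
  let σ : Equiv.Perm (Fin n) := Equiv.ofFiberEquiv fun i => (hcard i).some
  have hσ : ∀ x, c P' S' (σ x) = c P S x := fun x => Equiv.ofFiberEquiv_map _ x
  refine ⟨σ, Finset.eq_of_subset_of_card_le ?_ (by rw [Finset.card_map, hP]),
    Finset.eq_of_subset_of_card_le ?_ (by rw [Finset.card_map, hS])⟩
  · intro y hy
    obtain ⟨x, hx, rfl⟩ := Finset.mem_map.1 hy
    exact (hc0 P' S' _).1 ((hσ x).trans ((hc0 P S x).2 hx))
  · intro y hy
    obtain ⟨x, hx, rfl⟩ := Finset.mem_map.1 hy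
    exact (hc1 P' S' h' _).1 ((hσ x).trans ((hc1 P S h x).2 hx))

open Classical in
/-- The number of permutations that take `S` to a closed set in the link of the image of `P`. -/
noncomputable def closedPerms {n : ℕ} (F : Finset (Finset (Fin n))) (P S : Finset (Fin n)) :
    Finset (Equiv.Perm (Fin n)) :=
  Finset.univ.filter fun π => LinkClosed F (P.map π.toEmbedding) (S.map π.toEmbedding)

theorem mem_closedPerms {n : ℕ} {F : Finset (Finset (Fin n))} {P S : Finset (Fin n)}
    {π : Equiv.Perm (Fin n)} :
    π ∈ closedPerms F P S ↔ LinkClosed F (P.map π.toEmbedding) (S.map π.toEmbedding) := by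
  simp [closedPerms]

theorem card_closedPerms_eq {n : ℕ} (F : Finset (Finset (Fin n))) {P S P' S' : Finset (Fin n)}
    (h : Disjoint P S) (h' : Disjoint P' S') (hP : P.card = P'.card) (hS : S.card = S'.card) :
    (closedPerms F P S).card = (closedPerms F P' S').card := by
  obtain ⟨σ, rfl, rfl⟩ := exists_perm_map h h' hP hS
  refine Finset.card_equiv (Equiv.mulRight σ⁻¹) fun π => ?_
  simp only [closedPerms, Finset.mem_filter, Finset.mem_univ, true_and, Finset.map_map,
    Equiv.coe_mulRight]
  have : σ.toEmbedding.trans (π * σ⁻¹).toEmbedding = π.toEmbedding := by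
    ext x; simp
  rw [this]

open Classical in
/-- A random permutation makes `S` closed in the link of `P` with probability at most
`√((s + 1) / binom(n - p, s))`: by symmetry this probability is the proportion of closed sets
among all pairs `(P, S)` of the given sizes. -/
theorem IsCovering.card_closedPerms_sq_le {n p : ℕ} {F : Finset (Finset (Fin n))}
    (hF : IsCovering n (p + 1 + 1) (p + 1) F) {P S : Finset (Fin n)} (hP : P.card = p)
    (h : Disjoint P S) :
    ((closedPerms F P S).card : ℝ) ^ 2 * (n - p).choose S.card ≤
      (Fintype.card (Equiv.Perm (Fin n)) : ℝ) ^ 2 * (S.card + 1) := by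
  obtain ⟨s, hs⟩ : ∃ s, s = S.card := ⟨_, rfl⟩
  have hSP : S ⊆ Pᶜ := fun x hx => Finset.mem_compl.2 fun hx' => Finset.disjoint_left.1 h hx' hx
  have hsn : s ≤ n - p := by
    have := Finset.card_le_card hSP
    rwa [Finset.card_compl, Fintype.card_fin, hP, ← hs] at this
  have hpn : p ≤ n := by
    have := Finset.card_le_univ P
    rwa [Fintype.card_fin, hP] at this
  rw [← hs]
  -- All pairs `(Q, U)` with the sizes of `(P, S)`, and among them those with `U` closed.
  let T : Finset (Σ _ : Finset (Fin n), Finset (Fin n)) :=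
    ((Finset.univ : Finset (Fin n)).powersetCard p).sigma fun Q => (Qᶜ).powersetCard s
  have hTmem : ∀ q, q ∈ T ↔ q.1.card = p ∧ Disjoint q.1 q.2 ∧ q.2.card = s := by
    rintro ⟨Q, U⟩
    simp only [T, Finset.mem_sigma, Finset.mem_powersetCard, Finset.subset_univ, true_and]
    rw [Finset.subset_compl_iff_disjoint_left]
  have hTcard : T.card = n.choose p * (n - p).choose s := by
    rw [Finset.card_sigma, Finset.sum_congr rfl (g := fun _ => (n - p).choose s), Finset.sum_const,
      Finset.card_powersetCard, Finset.card_univ, Fintype.card_fin, smul_eq_mul]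
    intro Q hQ
    rw [Finset.card_powersetCard, Finset.card_compl, Fintype.card_fin,
      (Finset.mem_powersetCard.1 hQ).2]
  let X := T.filter fun q => LinkClosed F q.1 q.2
  have hXcard : (X.card : ℝ) ≤ n.choose p * √((s + 1) * (n - p).choose s) := by
    have : X = ((Finset.univ : Finset (Fin n)).powersetCard p).sigma
        fun Q => ((Qᶜ).powersetCard s).filter (LinkClosed F Q) := by
      ext ⟨Q, U⟩
      simp only [X, T, Finset.mem_sigma, Finset.mem_filter, and_assoc]
    rw [this, Finset.card_sigma, Nat.cast_sum]
    refine (Finset.sum_le_card_nsmul _ _ (√((s + 1) * (n - p).choose s)) fun Q hQ => ?_).trans ?_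
    · apply Real.le_sqrt_of_sq_le
      exact_mod_cast hF.card_linkClosed_sq_le (Finset.mem_powersetCard.1 hQ).2 s
    · simp
  -- Counting the pairs of a permutation and an element of `T` mapped into `X`.
  have hdc : (closedPerms F P S).card * T.card = Fintype.card (Equiv.Perm (Fin n)) * X.card := by
    calc (closedPerms F P S).card * T.card = ∑ q ∈ T, (closedPerms F q.1 q.2).card := by
          rw [Finset.sum_congr rfl (g := fun _ => (closedPerms F P S).card), Finset.sum_const,
            smul_eq_mul, mul_comm]
          intro q hq
          obtain ⟨h1, h2, h3⟩ := (hTmem q).1 hq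
          exact card_closedPerms_eq F h2 h (h1.trans hP.symm) (h3.trans hs)
      _ = ∑ π : Equiv.Perm (Fin n),
          (T.filter fun q => LinkClosed F (q.1.map π.toEmbedding) (q.2.map π.toEmbedding)).card := by
          simp only [closedPerms, Finset.card_filter]
          exact Finset.sum_comm
      _ = ∑ π : Equiv.Perm (Fin n), X.card := by
          refine Finset.sum_congr rfl fun π _ => ?_
          refine Finset.card_bij (fun q _ => ⟨q.1.map π.toEmbedding, q.2.map π.toEmbedding⟩) ?_ ?_ ?_
          · intro q hq
            obtain ⟨h1, h2⟩ := Finset.mem_filter.1 hq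
            rw [hTmem] at h1
            refine Finset.mem_filter.2 ⟨(hTmem _).2 ?_, h2⟩
            simpa [Finset.disjoint_map] using h1
          · rintro ⟨Q, U⟩ - ⟨Q', U'⟩ - heq
            simp only [Sigma.mk.injEq, heq_eq_eq, Finset.map_inj] at heq
            rw [heq.1, heq.2]
          · rintro ⟨Q, U⟩ hq
            obtain ⟨h1, h2⟩ := Finset.mem_filter.1 hq
            rw [hTmem] at h1
            have hinv : ∀ A : Finset (Fin n),
                (A.map π.symm.toEmbedding).map π.toEmbedding = A := fun A => by
              ext x; simp
            refine ⟨⟨Q.map π.symm.toEmbedding, U.map π.symm.toEmbedding⟩,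
              Finset.mem_filter.2 ⟨(hTmem _).2 ?_, ?_⟩, ?_⟩
            · simpa [Finset.disjoint_map] using h1
            · simpa only [hinv] using h2
            · simp only [hinv]
      _ = Fintype.card (Equiv.Perm (Fin n)) * X.card := by
          rw [Finset.sum_const, Finset.card_univ, smul_eq_mul]
  have hc : (0 : ℝ) < (n - p).choose s := by exact_mod_cast Nat.choose_pos hsn
  have hcp : (0 : ℝ) < n.choose p := by exact_mod_cast Nat.choose_pos hpn
  have hdcR : ((closedPerms F P S).card : ℝ) * (n.choose p * (n - p).choose s) =
      Fintype.card (Equiv.Perm (Fin n)) * X.card := by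
    rw [← Nat.cast_mul, ← hTcard]
    exact_mod_cast hdc
  have hle : ((closedPerms F P S).card : ℝ) * (n - p).choose s ≤
      Fintype.card (Equiv.Perm (Fin n)) * √((s + 1) * (n - p).choose s) := by
    have := mul_le_mul_of_nonneg_left hXcard
      (Nat.cast_nonneg (α := ℝ) (Fintype.card (Equiv.Perm (Fin n))))
    rw [← hdcR] at this
    refine le_of_mul_le_mul_left ?_ hcp
    linarith
  have hsq := pow_le_pow_left₀ (by positivity) hle 2
  rw [mul_pow, mul_pow, Real.sq_sqrt (by positivity)] at hsq
  refine le_of_mul_le_mul_right ?_ hc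
  linarith

/-- The bound on the expected number, for a fixed `P` with `v` elements outside, of sets `S` of at
most half size that are closed for four random permutations: each of the `binom(v, m)` sets of
size `m` contributes the fourth power of `√((m + 1) / binom(v, m))`. -/
theorem sum_closed_bound {v : ℕ} (hv : 2000 ≤ v) :
    ∑ m ∈ Finset.range (v + 1), (v.choose m : ℝ) *
      (if 1 ≤ m ∧ 2 * m ≤ v then (((m : ℝ) + 1) / v.choose m) ^ 2 else 0) ≤ 1 / 2 := by
  have hvR : (2000 : ℝ) ≤ v := by exact_mod_cast hv
  have hv0 : (0 : ℝ) < v := by linarith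
  -- `binom(v, r) ≥ (v / 2) ^ r / r!` for small `r`
  have hlow : ∀ r ≤ 4, ((v : ℝ) / 2) ^ r ≤ r.factorial * v.choose r := by
    intro r hr
    have h1 : (v + 1 - r) ^ r ≤ r.factorial * v.choose r := by
      rw [← Nat.descFactorial_eq_factorial_mul_choose]
      exact Nat.pow_sub_le_descFactorial v r
    have h2 : (v : ℝ) / 2 ≤ ((v + 1 - r : ℕ) : ℝ) := by
      rw [Nat.cast_sub (by omega)]
      push_cast
      have : (r : ℝ) ≤ 4 := by exact_mod_cast hr
      linarith
    calc ((v : ℝ) / 2) ^ r ≤ ((v + 1 - r : ℕ) : ℝ) ^ r := by gcongr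
      _ ≤ _ := by exact_mod_cast h1
  have hterm : ∀ m ∈ Finset.range (v + 1), (v.choose m : ℝ) *
      (if 1 ≤ m ∧ 2 * m ≤ v then (((m : ℝ) + 1) / v.choose m) ^ 2 else 0) ≤
      (if m = 1 then 4 / (v : ℝ) else 0) + 768 / (v : ℝ) ^ 2 := by
    intro m hm
    have hpos : (0 : ℝ) < v.choose m := by
      exact_mod_cast Nat.choose_pos (by simpa [Nat.lt_succ_iff] using hm)
    have h0 : 0 ≤ 768 / (v : ℝ) ^ 2 := by positivity
    split_ifs with h1 h2 h2
    · subst h2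
      rw [Nat.choose_one_right]
      have : (v : ℝ) * (((1 : ℕ) + 1 : ℝ) / v) ^ 2 = 4 / v := by
        push_cast
        field_simp
        norm_num
      rw [this]
      linarith
    · have hkey : ((m : ℝ) + 1) ^ 2 * v ^ 2 ≤ 768 * v.choose m := by
        rcases (show m = 2 ∨ m = 3 ∨ 4 ≤ m by omega) with rfl | rfl | h4
        · have := hlow 2 (by norm_num)
          norm_num [Nat.factorial] at this ⊢
          nlinarith
        · have := hlow 3 (by norm_num)
          norm_num [Nat.factorial] at this ⊢
          nlinarith [sq_nonneg (v : ℝ)]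
        · have h3 := hlow 4 le_rfl
          have hmono : v.choose 4 ≤ v.choose m := by
            have hstep : ∀ j, 2 * (4 + j) ≤ v → v.choose 4 ≤ v.choose (4 + j) := by
              intro j
              induction j with
              | zero => exact fun _ => le_rfl
              | succ j ih =>
                exact fun hj => (ih (by omega)).trans
                  (Nat.choose_le_succ_of_lt_half_left (by omega))
            have := hstep (m - 4) (by omega)
            rwa [Nat.add_sub_cancel' h4] at this
          have hmono' : (v.choose 4 : ℝ) ≤ v.choose m := by exact_mod_cast hmono
          have hm2 : (m : ℝ) + 1 ≤ v := by
            have : m + 1 ≤ v := by omega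
            exact_mod_cast this
          have h5 : ((m : ℝ) + 1) ^ 2 ≤ v ^ 2 := by gcongr
          norm_num [Nat.factorial] at h3
          calc ((m : ℝ) + 1) ^ 2 * (v : ℝ) ^ 2 ≤ (v : ℝ) ^ 2 * (v : ℝ) ^ 2 := by gcongr
            _ ≤ 768 * (v.choose 4 : ℝ) := by nlinarith
            _ ≤ 768 * (v.choose m : ℝ) := by gcongr
      rw [zero_add, le_div_iff₀ (by positivity)]
      calc (v.choose m : ℝ) * (((m : ℝ) + 1) / v.choose m) ^ 2 * v ^ 2
          = ((m : ℝ) + 1) ^ 2 * v ^ 2 / v.choose m := by field_simp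
        _ ≤ 768 := by rwa [div_le_iff₀ hpos]
    · have : (0 : ℝ) ≤ 4 / v := by positivity
      simp only [mul_zero]
      linarith
    · simp only [mul_zero]
      linarith
  refine (Finset.sum_le_sum hterm).trans ?_
  rw [Finset.sum_add_distrib, Finset.sum_ite_eq' , if_pos (Finset.mem_range.2 (by omega)),
    Finset.sum_const, Finset.card_range, nsmul_eq_mul]
  push_cast
  have : 4 / (v : ℝ) + (v + 1) * (768 / v ^ 2) = (4 * v + 768 * (v + 1)) / v ^ 2 := by
    field_simp
  rw [this, div_le_iff₀ (by positivity)]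
  nlinarith

open Classical in
/-- The pairs `(P, S)`, with `|P| = p` and `S` at most half of the complement of `P`, such that `S`
is closed in the link of `P` for all four permuted coverings. -/
noncomputable def badPairs {n : ℕ} (F : Finset (Finset (Fin n))) (p : ℕ)
    (π : Fin 4 → Equiv.Perm (Fin n)) : Finset (Σ _ : Finset (Fin n), Finset (Fin n)) :=
  ((Finset.univ : Finset (Fin n)).powersetCard p).sigma fun P =>
    (Pᶜ).powerset.filter fun S => (1 ≤ S.card ∧ 2 * S.card ≤ n - p) ∧ ∀ i, π i ∈ closedPerms F P S

open Classical in
/-- First moment method: on average over four independent permutations, there are few bad pairs. -/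
theorem IsCovering.exists_card_badPairs_le {n p : ℕ} {F : Finset (Finset (Fin n))}
    (hF : IsCovering n (p + 1 + 1) (p + 1) F) (hn : 2000 ≤ n - p) :
    ∃ π, ((badPairs F p π).card : ℝ) ≤ n.choose p / 2 := by
  obtain ⟨M, hM⟩ : ∃ M, M = (Fintype.card (Equiv.Perm (Fin n)) : ℝ) := ⟨_, rfl⟩
  have hM0 : 0 < M := by rw [hM]; exact_mod_cast Fintype.card_pos
  -- The contribution of a fixed `P` to the expected number of bad pairs is at most `1 / 2`.
  have hpair : ∀ P ∈ (Finset.univ : Finset (Fin n)).powersetCard p,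
      ∑ S ∈ (Pᶜ).powerset,
        (if 1 ≤ S.card ∧ 2 * S.card ≤ n - p then ((closedPerms F P S).card : ℝ) ^ 4 else 0) ≤
          M ^ 4 * (1 / 2) := by
    intro P hP
    have hP := (Finset.mem_powersetCard.1 hP).2
    have hPc : (Pᶜ).card = n - p := by rw [Finset.card_compl, Fintype.card_fin, hP]
    calc _ ≤ ∑ S ∈ (Pᶜ).powerset, M ^ 4 * (if 1 ≤ S.card ∧ 2 * S.card ≤ n - p then
            (((S.card : ℝ) + 1) / (n - p).choose S.card) ^ 2 else 0) := by
          refine Finset.sum_le_sum fun S hS => ?_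
          split_ifs with h
          · have hdisj : Disjoint P S := by
              rw [Finset.mem_powerset] at hS
              exact Finset.disjoint_left.2 fun x hx hx' => Finset.mem_compl.1 (hS hx') hx
            have hsq := hF.card_closedPerms_sq_le hP hdisj
            rw [← hM] at hsq
            have hpos : (0 : ℝ) < (n - p).choose S.card := by
              exact_mod_cast Nat.choose_pos (by omega)
            rw [← le_div_iff₀ hpos] at hsq
            calc ((closedPerms F P S).card : ℝ) ^ 4 = (((closedPerms F P S).card : ℝ) ^ 2) ^ 2 := by
                  ring
              _ ≤ (M ^ 2 * (S.card + 1) / (n - p).choose S.card) ^ 2 := by gcongr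
              _ = _ := by ring
          · simp
      _ = M ^ 4 * ∑ m ∈ Finset.range (n - p + 1), ((n - p).choose m : ℝ) *
          (if 1 ≤ m ∧ 2 * m ≤ n - p then (((m : ℝ) + 1) / (n - p).choose m) ^ 2 else 0) := by
          rw [← Finset.mul_sum, Finset.sum_powerset_apply_card
            (fun m => if 1 ≤ m ∧ 2 * m ≤ n - p then (((m : ℝ) + 1) / (n - p).choose m) ^ 2 else 0),
            hPc]
          simp only [nsmul_eq_mul]
      _ ≤ M ^ 4 * (1 / 2) := by gcongr; exact sum_closed_bound hn
  have htot : ∑ π : Fin 4 → Equiv.Perm (Fin n), ((badPairs F p π).card : ℝ) ≤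
      ∑ π : Fin 4 → Equiv.Perm (Fin n), (n.choose p : ℝ) / 2 := by
    calc ∑ π : Fin 4 → Equiv.Perm (Fin n), ((badPairs F p π).card : ℝ)
        = ∑ P ∈ (Finset.univ : Finset (Fin n)).powersetCard p, ∑ S ∈ (Pᶜ).powerset,
          ∑ π : Fin 4 → Equiv.Perm (Fin n),
          (if (1 ≤ S.card ∧ 2 * S.card ≤ n - p) ∧ ∀ i, π i ∈ closedPerms F P S
            then (1 : ℝ) else 0) := by
          simp only [badPairs, Finset.card_sigma, Nat.cast_sum, Finset.card_filter, Nat.cast_ite,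
            Nat.cast_one, Nat.cast_zero]
          rw [Finset.sum_comm]
          exact Finset.sum_congr rfl fun P _ => Finset.sum_comm
      _ = ∑ P ∈ (Finset.univ : Finset (Fin n)).powersetCard p, ∑ S ∈ (Pᶜ).powerset,
          (if 1 ≤ S.card ∧ 2 * S.card ≤ n - p then
            ((closedPerms F P S).card : ℝ) ^ 4 else 0) := by
          refine Finset.sum_congr rfl fun P _ => Finset.sum_congr rfl fun S _ => ?_
          split_ifs with h
          · simp only [h, true_and, and_self]
            rw [Finset.sum_boole]
            have : (Finset.univ.filter fun π : Fin 4 → Equiv.Perm (Fin n) =>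
                ∀ i, π i ∈ closedPerms F P S) = Fintype.piFinset fun _ => closedPerms F P S := by
              ext π
              simp
            rw [this, Fintype.card_piFinset_const]
            push_cast
            simp
          · simp only [h, false_and, if_false, Finset.sum_const_zero]
      _ ≤ ∑ P ∈ (Finset.univ : Finset (Fin n)).powersetCard p, M ^ 4 * (1 / 2) :=
          Finset.sum_le_sum hpair
      _ = ∑ π : Fin 4 → Equiv.Perm (Fin n), (n.choose p : ℝ) / 2 := by
          rw [Finset.sum_const, Finset.sum_const, Finset.card_powersetCard, Finset.card_univ,
            Finset.card_univ, Fintype.card_fin, Fintype.card_fun, Fintype.card_fin, nsmul_eq_mul,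
            nsmul_eq_mul, Nat.cast_pow, ← hM]
          ring
  obtain ⟨π, -, hπ⟩ := Finset.exists_le_of_sum_le Finset.univ_nonempty htot
  exact ⟨π, hπ⟩

/-! ### The upper bound -/

/-- The implications `B \ {b} → b` for the blocks `B` of a permuted system. -/
theorem exists_block_clauses {n p : ℕ} {F : Finset (Finset (Fin n))}
    (hF : ∀ B ∈ F, B.card = p + 1 + 1) (π : Equiv.Perm (Fin n)) :
    ∃ Φ : Finset (Finset (Literal n)), Φ ⊆ Psi n (p + 1) ∧ Φ.card ≤ (p + 1 + 1) * F.card ∧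
      ∀ P x y, x ∉ P → y ∉ P → y ≠ x →
        insert (π x) (insert (π y) (P.map π.toEmbedding)) ∈ F →
          hornClause (insert x P) y ∈ Φ := by
  refine ⟨(F.sigma fun B => B).image fun q =>
    hornClause ((q.1.erase q.2).map π.symm.toEmbedding) (π.symm q.2), ?_, ?_, ?_⟩
  · intro C hC
    obtain ⟨⟨B, b⟩, hq, rfl⟩ := Finset.mem_image.1 hC
    obtain ⟨hB, hb⟩ := Finset.mem_sigma.1 hq
    have := hornClause_mem_Psi (A := (B.erase b).map π.symm.toEmbedding) (b := π.symm b) (by simp)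
    rwa [Finset.card_map, Finset.card_erase_of_mem hb, hF B hB, Nat.add_sub_cancel] at this
  · refine Finset.card_image_le.trans ?_
    rw [Finset.card_sigma, Finset.sum_congr rfl hF, Finset.sum_const, smul_eq_mul, mul_comm]
  · intro P x y hx hy hne hmem
    refine Finset.mem_image.2 ⟨⟨_, π y⟩, Finset.mem_sigma.2 ⟨hmem, by simp⟩, ?_⟩
    have : (insert (π x) (insert (π y) (P.map π.toEmbedding))).erase (π y) =
        (insert x P).map π.toEmbedding := by
      ext z
      obtain ⟨w, rfl⟩ := π.surjective z
      simp only [Finset.mem_erase, Finset.mem_insert, Finset.mem_map_equiv, ne_eq,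
        EmbeddingLike.apply_eq_iff_eq, Equiv.symm_apply_apply]
      refine ⟨fun ⟨h1, h2⟩ => by tauto, fun h => ⟨?_, by tauto⟩⟩
      rintro rfl
      exact h.elim hne hy
    simp only [this, Equiv.symm_apply_apply]
    congr 1
    ext z
    simp

/-- Four permuted coverings leave few bad pairs; each of these is repaired by two implications. -/
theorem upper_bound {n p : ℕ} (hn : 2000 ≤ n - p) (hp : p + 1 ≤ 2 * (n - p)) :
    ∃ φ ⊆ Psi n (p + 1), UcpEquiv φ (Psi n (p + 1)) ∧
      φ.card ≤ 6 * (p + 1 + 1) * coveringNumber n (p + 1 + 1) (p + 1) := by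
  classical
  obtain ⟨F, hF, hFcard⟩ := exists_isCovering_card_eq (n := n) (k := p + 1) (by omega)
  obtain ⟨π, hπ⟩ := hF.exists_card_badPairs_le hn
  choose Φ hΦPsi hΦcard hΦ using fun i => exists_block_clauses hF.1 (π i)
  have hbad : ∀ q : Σ _ : Finset (Fin n), Finset (Fin n), ∃ x y,
      q ∈ badPairs F p π → q.1.card = p ∧ x ∈ q.2 ∧ x ∉ q.1 ∧ y ∉ q.1 ∧ y ∉ q.2 := by
    rintro ⟨P, S⟩
    by_cases hq : (⟨P, S⟩ : Σ _ : Finset (Fin n), Finset (Fin n)) ∈ badPairs F p π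
    · obtain ⟨hP, hS⟩ := Finset.mem_sigma.1 hq
      have hP := (Finset.mem_powersetCard.1 hP).2
      obtain ⟨hSP, ⟨h1, h2⟩, -⟩ := Finset.mem_filter.1 hS
      simp only at hP h1 h2 hSP
      obtain ⟨x, hx⟩ := Finset.card_pos.1 h1
      obtain ⟨y, hy, hyS⟩ := Finset.exists_mem_notMem_of_card_lt_card (s := S) (t := Pᶜ) (by
        rw [Finset.card_compl, Fintype.card_fin, hP]; omega)
      exact ⟨x, y, fun _ => ⟨hP, hx, Finset.mem_compl.1 (Finset.mem_powerset.1 hSP hx),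
        Finset.mem_compl.1 hy, hyS⟩⟩
    · have : 0 < n := by omega
      exact ⟨⟨0, this⟩, ⟨0, this⟩, fun h => absurd h hq⟩
  choose x y hxy using hbad
  let φ := Finset.univ.biUnion Φ ∪
    ((badPairs F p π).image (fun q => hornClause (insert (x q) q.1) (y q)) ∪
      (badPairs F p π).image fun q => hornClause (insert (y q) q.1) (x q))
  have hφ : φ ⊆ Psi n (p + 1) := by
    refine Finset.union_subset (Finset.biUnion_subset.2 fun i _ => hΦPsi i)
      (Finset.union_subset ?_ ?_)
    · intro C hC
      obtain ⟨q, hq, rfl⟩ := Finset.mem_image.1 hC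
      obtain ⟨hcard, hx, hxP, hyP, hy⟩ := hxy q hq
      have := hornClause_mem_Psi (A := insert (x q) q.1) (b := y q)
        (by simp only [Finset.mem_insert, not_or]; exact ⟨fun h => hy (h ▸ hx), hyP⟩)
      rwa [Finset.card_insert_of_notMem hxP, hcard] at this
    · intro C hC
      obtain ⟨q, hq, rfl⟩ := Finset.mem_image.1 hC
      obtain ⟨hcard, hx, hxP, hyP, hy⟩ := hxy q hq
      have := hornClause_mem_Psi (A := insert (y q) q.1) (b := x q)
        (by simp only [Finset.mem_insert, not_or]; exact ⟨fun h => hy (h ▸ hx), hxP⟩)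
      rwa [Finset.card_insert_of_notMem hyP, hcard] at this
  -- A set that is not too large can be both left and entered.
  have hhalf : ∀ P S : Finset (Fin n), P.card = p → Disjoint P S → 1 ≤ S.card →
      2 * S.card ≤ n - p → ∃ u ∈ S, ∃ w, w ∉ P ∧ w ∉ S ∧ hornClause (insert u P) w ∈ φ ∧
        ∃ u' ∈ S, ∃ w', w' ∉ P ∧ w' ∉ S ∧ hornClause (insert w' P) u' ∈ φ := by
    intro P S hP hdisj h1 h2
    have hSP : S ⊆ Pᶜ := fun z hz => Finset.mem_compl.2 fun h => Finset.disjoint_left.1 hdisj h hz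
    by_cases hcl : ∀ i, π i ∈ closedPerms F P S
    · have hq : (⟨P, S⟩ : Σ _ : Finset (Fin n), Finset (Fin n)) ∈ badPairs F p π :=
        Finset.mem_sigma.2 ⟨Finset.mem_powersetCard.2 ⟨Finset.subset_univ _, hP⟩,
          Finset.mem_filter.2 ⟨Finset.mem_powerset.2 hSP, ⟨h1, h2⟩, hcl⟩⟩
      obtain ⟨-, hx, -, hyP, hy⟩ := hxy _ hq
      exact ⟨_, hx, _, hyP, hy, Finset.mem_union_right _ (Finset.mem_union_left _
          (Finset.mem_image.2 ⟨_, hq, rfl⟩)),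
        _, hx, _, hyP, hy, Finset.mem_union_right _ (Finset.mem_union_right _
          (Finset.mem_image.2 ⟨_, hq, rfl⟩))⟩
    · push Not at hcl
      obtain ⟨i, hi⟩ := hcl
      rw [mem_closedPerms, LinkClosed] at hi
      push Not at hi
      obtain ⟨u, hu, w, hw, hne, hmem, hwS⟩ := hi
      obtain ⟨u, rfl⟩ := (π i).surjective u
      obtain ⟨w, rfl⟩ := (π i).surjective w
      simp only [Finset.mem_map_equiv, Equiv.symm_apply_apply] at hu hw hwS
      have hne' : w ≠ u := fun h => hne (by rw [h])
      have huP := Finset.mem_compl.1 (hSP hu)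
      refine ⟨u, hu, w, hw, hwS, ?_, u, hu, w, hw, hwS, ?_⟩
      · exact Finset.mem_union_left _ (Finset.mem_biUnion.2
          ⟨i, Finset.mem_univ _, hΦ i P u w huP hw hne' hmem⟩)
      · exact Finset.mem_union_left _ (Finset.mem_biUnion.2
          ⟨i, Finset.mem_univ _, hΦ i P w u hw huP hne'.symm
            (Finset.insert_comm (π i u) (π i w) _ ▸ hmem)⟩)
  refine ⟨φ, hφ, ucpEquiv_Psi_of_exits (by omega) hφ ?_, ?_⟩
  · intro P S hP hdisj hS hex
    have hP : P.card = p := by omega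
    by_cases h2 : 2 * S.card ≤ n - p
    · obtain ⟨u, hu, w, hwP, hw, hmem, -⟩ := hhalf P S hP hdisj (Finset.card_pos.2 hS) h2
      exact ⟨u, hu, w, hwP, hw, hmem⟩
    · -- Leaving a large set is entering its complement.
      have hcard : (P ∪ S)ᶜ.card = n - (p + S.card) := by
        rw [Finset.card_compl, Fintype.card_fin, Finset.card_union_of_disjoint hdisj, hP]
      obtain ⟨y, hyP, hyS⟩ := hex
      obtain ⟨-, -, -, -, -, -, u, hu, w, hwP, hw, hmem⟩ := hhalf P (P ∪ S)ᶜ hP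
        (Finset.disjoint_left.2 fun z hz hz' =>
          Finset.mem_compl.1 hz' (Finset.mem_union_left _ hz))
        (Finset.card_pos.2 ⟨y, by simp [hyP, hyS]⟩) (by rw [hcard]; omega)
      simp only [Finset.mem_compl, Finset.mem_union, not_or, not_and, not_not] at hu hw
      exact ⟨w, hw hwP, u, hu.1, hu.2, hmem⟩
  · have hb : (badPairs F p π).card ≤ n.choose (p + 1) := by
      have h1 : n.choose (p + 1) * (p + 1) = n.choose p * (n - p) := Nat.choose_succ_right_eq n p
      have h2 : 2 * (badPairs F p π).card ≤ n.choose p := by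
        have : (2 : ℝ) * (badPairs F p π).card ≤ n.choose p := by linarith
        exact_mod_cast this
      refine Nat.le_of_mul_le_mul_right (c := 2 * (n - p)) ?_ (by omega)
      calc (badPairs F p π).card * (2 * (n - p)) = 2 * (badPairs F p π).card * (n - p) := by ring
        _ ≤ n.choose p * (n - p) := Nat.mul_le_mul_right _ h2
        _ = n.choose (p + 1) * (p + 1) := h1.symm
        _ ≤ n.choose (p + 1) * (2 * (n - p)) := Nat.mul_le_mul_left _ hp
    have hΦtot : (Finset.univ.biUnion Φ).card ≤ 4 * ((p + 1 + 1) * F.card) := by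
      simpa using Finset.card_biUnion_le_card_mul Finset.univ Φ _ fun i _ => hΦcard i
    have hC := hF.choose_le
    rw [← hFcard]
    have h1 := Finset.card_image_le (s := badPairs F p π)
      (f := fun q => hornClause (insert (x q) q.1) (y q))
    have h2 := Finset.card_image_le (s := badPairs F p π)
      (f := fun q => hornClause (insert (y q) q.1) (x q))
    calc φ.card ≤ _ := (Finset.card_union_le _ _).trans
          (Nat.add_le_add_left (Finset.card_union_le _ _) _)
      _ ≤ 4 * ((p + 1 + 1) * F.card) + ((p + 1 + 1) * F.card + (p + 1 + 1) * F.card) := by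
          gcongr
          · exact h1.trans (hb.trans hC)
          · exact h2.trans (hb.trans hC)
      _ = 6 * (p + 1 + 1) * F.card := by ring

end UcpCNF

theorem mainTheorem2 :
    (∀ n k : ℕ, 1 ≤ k → k ≤ n - 1 →
      (∀ φ : Finset (Finset (UcpCNF.Literal n)),
        UcpCNF.IsCNF φ → UcpCNF.UcpEquiv φ (UcpCNF.Psi n k) →
          n * UcpCNF.coveringNumber (n - 1) k (k - 1) ≤ φ.card) ∧
      (n : ℝ) * (UcpCNF.coveringNumber (n - 1) k (k - 1) : ℝ)
        = (n.choose k : ℝ) * UcpCNF.mu (n - 1) (k - 1) ∧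
      (n.choose k : ℝ) ≤ (n.choose k : ℝ) * UcpCNF.mu (n - 1) (k - 1)) ∧
    (∀ c : ℝ, ∃ N : ℕ, ∃ K : ℝ, ∀ n k : ℕ, N ≤ n → 1 ≤ k → k ≤ n - 1 →
      |(k : ℝ) - (n : ℝ) / 2| ≤ c →
        (∃ φ : Finset (Finset (UcpCNF.Literal n)),
          UcpCNF.IsCNF φ ∧ UcpCNF.UcpEquiv φ (UcpCNF.Psi n k) ∧
            φ.card ≤ 6 * (k + 1) * UcpCNF.coveringNumber n (k + 1) k) ∧
        6 * ((k : ℝ) + 1) * (UcpCNF.coveringNumber n (k + 1) k : ℝ)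
          = 6 * (n.choose k : ℝ) * UcpCNF.mu n k ∧
        6 * (n.choose k : ℝ) * UcpCNF.mu n k
          ≤ K * Real.log (n : ℝ) * (n.choose k : ℝ)) := by
  refine ⟨fun n k hk hkn => ⟨fun φ _ h => UcpCNF.lower_bound hk hkn h, ?_, ?_⟩, fun c => ?_⟩
  · obtain ⟨j, rfl⟩ : ∃ j, k = j + 1 := ⟨k - 1, by omega⟩
    obtain ⟨m, rfl⟩ : ∃ m, n = m + 1 := ⟨n - 1, by omega⟩
    simp only [Nat.add_sub_cancel] at hkn ⊢
    have h1 := UcpCNF.choose_mul_mu (n := m) (k := j) (by omega)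
    have h2 : ((m : ℝ) + 1) * m.choose j = (m + 1).choose (j + 1) * ((j : ℝ) + 1) := by
      exact_mod_cast Nat.add_one_mul_choose_eq m j
    have hj : (0 : ℝ) < (j : ℝ) + 1 := by positivity
    refine mul_left_cancel₀ hj.ne' ?_
    push_cast
    linear_combination ((m : ℝ) + 1) * (-h1) + UcpCNF.mu m j * h2
  · exact le_mul_of_one_le_right (Nat.cast_nonneg _) (UcpCNF.one_le_mu (by omega))
  · refine ⟨⌈6 * |c|⌉₊ + 6000, 18, fun n k hN hk hkn hc => ?_⟩
    have hNR : 6 * |c| + 6000 ≤ n := by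
      have h1 := Nat.le_ceil (6 * |c|)
      have h2 : ((⌈6 * |c|⌉₊ + 6000 : ℕ) : ℝ) ≤ n := by exact_mod_cast hN
      push_cast at h2
      linarith
    have hkc := abs_le.1 (hc.trans (le_abs_self c))
    obtain ⟨p, rfl⟩ : ∃ p, k = p + 1 := ⟨k - 1, by omega⟩
    have hsub : ((n - p : ℕ) : ℝ) = n - p := Nat.cast_sub (by omega)
    push_cast at hkc
    refine ⟨?_, ?_, ?_⟩
    · obtain ⟨φ, hsubset, heq, hcard⟩ := UcpCNF.upper_bound (n := n) (p := p)
        (by have : ((2000 : ℕ) : ℝ) ≤ (n - p : ℕ) := by rw [hsub]; push_cast; linarith [abs_nonneg c]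
            exact_mod_cast this)
        (by have : ((p + 1 : ℕ) : ℝ) ≤ ((2 * (n - p) : ℕ) : ℝ) := by
              rw [Nat.cast_mul, hsub]; push_cast; linarith [abs_nonneg c]
            exact_mod_cast this)
      exact ⟨φ, fun C hC => (Finset.mem_filter.1 (hsubset hC)).2.1, heq, hcard⟩
    · rw [mul_assoc, mul_assoc, UcpCNF.choose_mul_mu (by omega)]
    · have hmu := UcpCNF.mu_le_log (n := n) (k := p + 1) (by omega)
      have hn0 : (0 : ℝ) < n := by linarith [abs_nonneg c]
      have hlog1 : 1 ≤ Real.log n := by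
        rw [Real.le_log_iff_exp_le hn0]
        linarith [Real.exp_one_lt_d9, abs_nonneg c]
      have hlog2 : Real.log ((p + 1 : ℕ) + 1) ≤ Real.log n := by
        apply Real.log_le_log (by positivity)
        have : p + 1 + 1 ≤ n := by omega
        exact_mod_cast this
      have hle : UcpCNF.mu n (p + 1) ≤ 3 * Real.log n := by linarith
      calc 6 * (n.choose (p + 1) : ℝ) * UcpCNF.mu n (p + 1)
          ≤ 6 * (n.choose (p + 1) : ℝ) * (3 * Real.log n) := by gcongr
        _ = 18 * Real.log n * (n.choose (p + 1) : ℝ) := by ring
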